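/- Let $m\ge 0$, $\alpha\in[0,1]$, $c>0$. A \emph{rectifiable $1$-current} $T=\underline{\underline{\tau}}(M,\theta,\xi)$ in $\mathbb{R}^m$ is the current $T(\omega)=\int_M\langle\omega(x),\xi(x)\rangle\,\theta(x)\,d\mathcal{H}^1(x)$ on smooth compactly supported $1$-forms, where $M\subset\mathbb{R}^m$ is $\mathcal{H}^1$-measurable and countably $1$-rectifiable, $\theta>0$ on $M$ is locally $\mathcal{H}^1$-integrable on $M$, and $\xi$ is an $\mathcal{H}^1$-measurable unit vector field orienting the approximate tangent line of $M$ (with respect to $\theta$) at $\mathcal{H}^1$-a.e. point of $M$. For finite Borel measures $\nu^\pm$ of equal mass, $T\in Path(\nu^-,\nu^+)$ means $\partial T=\nu^+-\nu^-$. Put $$\mathbf{M}_\alpha(T)=\int_M\theta^\alpha\,d\mathcal{H}^1,\qquad \mathbf{M}_{\alpha,c}(T)=c^\alpha\int_M\left\lfloor\frac{\theta(x)}{c}\right\rfloor+\left(\frac{\theta(x)}{c}-\left\lfloor\frac{\theta(x)}{c}\right\rfloor\right)^{\alpha}d\mathcal{H}^1(x),$$ with values in $[0,\infty]$ and with the convention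 $0^0=0$ in the second integrand (so that it equals $n$ where $\theta(x)=nc$, $n\in\mathbb{N}$). Let $\mu^-,\mu^+$ be finite Borel measures on $\mathbb{R}^m$ of equal mass, supported on compact sets. Let $\vec T=(T_1,T_2,\dots)\in Path_c(\mu^-,\mu^+)$ be a transport multi-path with capacity $c$: there are measures $\mu_k^\pm$ with $T_k\in Path(\mu_k^-,\mu_k^+)$, $\sum_k\mu_k^-=\mu^-$, $\sum_k\mu_k^+=\mu^+$ and $0<\|\mu_k^-\|=\|\mu_k^+\|\le c$ for every $k\geq 1$; write $\mathbf{M}_\alpha(\vec T)=\sum_{k=1}^\infty\mathbf{M}_\alpha(T_k)$. Suppose that $T_k=\underline{\underline{\tau}}(M_k,\theta_k,\xi_k)$ with $\theta_k(x)\le\|\mu_k^-\|=\|\mu_k^+\|$ for all $x\in M_k$ and all $k$. Then: (i) whenever a rectifiable $1$-current $T$ is the sum $T=\sum_{k=1}^\infty T_k$ (i.e. the partial sums converge weakly to $T$), one has $T\in Path(\mu^-,\mu^+)$ and $$\mathbf{M}_{\alpha,c}(T)\le\mathbf{M}_\alpha(\vec T);$$ (ii) if $\mathbf{M}_\alpha(\vec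 T)<\infty$, then such a rectifiable $1$-current $T=\sum_{k=1}^\infty T_k$ exists. -/

import Mathlib

open MeasureTheory Set Filter Topology TopologicalSpace
open scoped ENNReal Distributions

namespace CapacityTransport

noncomputable section

/-- Euclidean space `ℝ^m`. -/
abbrev E (m : ℕ) : Type := EuclideanSpace ℝ (Fin m)

/-- Compactly supported smooth `0`-forms (functions) on `ℝ^m`. -/
abbrev ZeroForm (m : ℕ) : Type := 𝓓((⊤ : Opens (E m)), ℝ)

/-- Compactly supported smooth `1`-forms on `ℝ^m`. -/
abbrev OneForm (m : ℕ) : Type := 𝓓((⊤ : Opens (E m)), E m →L[ℝ] ℝ)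

/-- `0`-currents in `ℝ^m`: the dual space of the compactly supported smooth functions. -/
abbrev ZeroCurrent (m : ℕ) : Type := ZeroForm m →L[ℝ] ℝ

/-- `1`-currents in `ℝ^m`: the dual space of the compactly supported smooth `1`-forms. -/
abbrev OneCurrent (m : ℕ) : Type := OneForm m →L[ℝ] ℝ

/-- The exterior derivative `d` from functions to `1`-forms. -/
def extD (m : ℕ) : ZeroForm m →L[ℝ] OneForm m := TestFunction.fderivCLM ℝ ⊤ ⊤

theorem extD_apply {m : ℕ} (f : ZeroForm m) (x : E m) : extD m f x = fderiv ℝ f x := by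
  simp [extD]

/-- The boundary of a `1`-current: `(∂T)(f) = T(df)`. -/
def boundary {m : ℕ} (T : OneCurrent m) : ZeroCurrent m := T.comp (extD m)

/-- The `0`-current `f ↦ ∫ f dμ` of a (locally finite) measure `μ`. -/
def measureCurrent {m : ℕ} (μ : Measure (E m)) : ZeroCurrent m :=
  TestFunction.integralAgainstBilinCLM (ContinuousLinearMap.mul ℝ ℝ) μ (fun _ => (1 : ℝ))

theorem measureCurrent_apply {m : ℕ} (μ : Measure (E m)) [IsFiniteMeasure μ] (f : ZeroForm m) :
    measureCurrent μ f = ∫ x, f x ∂μ := by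
  have h : LocallyIntegrableOn (fun _ : E m => (1 : ℝ)) (⊤ : Opens (E m)) μ :=
    ((integrable_const (1 : ℝ)).locallyIntegrable).locallyIntegrableOn _
  rw [measureCurrent, TestFunction.integralAgainstBilinCLM_eq_integral h]
  simp

/-- `M` is countably `1`-rectifiable: up to an `ℋ¹`-null set it is covered by countably many
Lipschitz images of the real line. -/
def CountablyRectifiable {m : ℕ} (M : Set (E m)) : Prop :=
  ∃ f : ℕ → ℝ → E m, (∀ j, ∃ K, LipschitzWith K (f j)) ∧ μH[1] (M \ ⋃ j, range (f j)) = 0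

/-- For a unit vector `v`, the line `ℝ v` is the approximate tangent space at `x` of the set `M`
with respect to the multiplicity `θ`: the rescalings about `x` of the measure `θ ℋ¹⌞M` converge,
against continuous compactly supported functions, to `θ(x) ℋ¹⌞(ℝ v)`. -/
def IsApproxTangent {m : ℕ} (M : Set (E m)) (θ : E m → ℝ) (x v : E m) : Prop :=
  ∀ φ : E m → ℝ, Continuous φ → HasCompactSupport φ →
    Tendsto (fun r : ℝ => r⁻¹ * ∫ y in M, φ (r⁻¹ • (y - x)) * θ y ∂μH[1])
      (𝓝[>] 0) (𝓝 (θ x * ∫ t : ℝ, φ (t • v)))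

/-- A (real multiplicity) rectifiable `1`-current `τ(M, θ, ξ)` in `ℝ^m`: an `ℋ¹`-measurable
countably `1`-rectifiable set `M`, a positive locally `ℋ¹`-integrable multiplicity `θ` on `M`, and
an `ℋ¹`-measurable unit vector field `ξ` orienting the approximate tangent line of `M` at `ℋ¹`-almost
every point of `M`. The values of `θ` and `ξ` off `M` play no role. -/
structure RectifiableCurrent (m : ℕ) where
  M : Set (E m)
  θ : E m → ℝ
  ξ : E m → E m
  nullMeasurableSet : NullMeasurableSet M μH[1]
  rectifiable : CountablyRectifiable M
  θ_pos : ∀ x ∈ M, 0 < θ x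
  θ_locallyIntegrable : LocallyIntegrable θ (μH[1].restrict M)
  ξ_measurable : AEStronglyMeasurable ξ (μH[1].restrict M)
  ξ_unit : ∀ᵐ x ∂(μH[1].restrict M), ‖ξ x‖ = 1
  ξ_tangent : ∀ᵐ x ∂(μH[1].restrict M), IsApproxTangent M θ x (ξ x)

/-- The `1`-current `ω ↦ ∫_M ⟨ω(x), ξ(x)⟩ θ(x) dℋ¹(x)` given by `τ(M, θ, ξ)`. -/
def RectifiableCurrent.toCurrent {m : ℕ} (T : RectifiableCurrent m) : OneCurrent m :=
  TestFunction.integralAgainstBilinCLM (ContinuousLinearMap.id ℝ (E m →L[ℝ] ℝ))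
    (μH[1].restrict T.M) (fun x => T.θ x • T.ξ x)

theorem RectifiableCurrent.toCurrent_apply {m : ℕ} (T : RectifiableCurrent m) (ω : OneForm m) :
    T.toCurrent ω = ∫ x in T.M, T.θ x * ω x (T.ξ x) ∂μH[1] := by
  have h : LocallyIntegrableOn (fun x => T.θ x • T.ξ x) (⊤ : Opens (E m))
      (μH[1].restrict T.M) := by
    refine LocallyIntegrable.locallyIntegrableOn ?_ _
    refine T.θ_locallyIntegrable.mono
      (T.θ_locallyIntegrable.aestronglyMeasurable.smul T.ξ_measurable) ?_
    filter_upwards [T.ξ_unit] with x hx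
    simp [norm_smul, hx]
  rw [RectifiableCurrent.toCurrent, TestFunction.integralAgainstBilinCLM_eq_integral h]
  simp

/-- `T ∈ Path(μ⁻, μ⁺)`: `T` is a rectifiable `1`-current with `∂T = μ⁺ - μ⁻`. -/
def IsTransportPath {m : ℕ} (μm μp : Measure (E m)) (T : RectifiableCurrent m) : Prop :=
  boundary T.toCurrent = measureCurrent μp - measureCurrent μm

/-- `𝐌_α(T) = ∫_M θ^α dℋ¹`. -/
def costM {m : ℕ} (α : ℝ) (T : RectifiableCurrent m) : ℝ≥0∞ :=
  ∫⁻ x in T.M, ENNReal.ofReal (T.θ x ^ α) ∂μH[1]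

/-- `H_{c,α}(t) = ⌊t/c⌋ + (t/c - ⌊t/c⌋)^α`, where the second term is `0` when `t/c` is an integer,
so that `H_{c,α}(n c) = n` (also for `α = 0`, that is, with the convention `0 ^ 0 = 0`). -/
def capacityProfile (α c t : ℝ) : ℝ :=
  (⌊t / c⌋ : ℝ) + if Int.fract (t / c) = 0 then 0 else Int.fract (t / c) ^ α

/-- `𝐌_{α,c}(T) = c^α ∫_M ⌊θ/c⌋ + (θ/c - ⌊θ/c⌋)^α dℋ¹`. -/
def costMCap {m : ℕ} (α c : ℝ) (T : RectifiableCurrent m) : ℝ≥0∞ :=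
  ENNReal.ofReal (c ^ α) * ∫⁻ x in T.M, ENNReal.ofReal (capacityProfile α c (T.θ x)) ∂μH[1]

/-- `T⃗ = (T_k) ∈ Path_c(μ⁻, μ⁺)`, with `T_k ∈ Path(νm k, νp k)`: a transport multi-path from
`μ⁻` to `μ⁺` with capacity `c`. -/
structure IsTransportMultiPath {m : ℕ} (c : ℝ) (μm μp : Measure (E m))
    (νm νp : ℕ → Measure (E m)) (T : ℕ → RectifiableCurrent m) : Prop where
  path : ∀ k, IsTransportPath (νm k) (νp k) (T k)
  sum_source : Measure.sum νm = μm
  sum_target : Measure.sum νp = μp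
  mass_pos : ∀ k, 0 < νm k univ
  mass_eq : ∀ k, νm k univ = νp k univ
  mass_le : ∀ k, νm k univ ≤ ENNReal.ofReal c

/-- `𝐌_α(T⃗) = ∑_k 𝐌_α(T_k)`. -/
def costMulti {m : ℕ} (α : ℝ) (T : ℕ → RectifiableCurrent m) : ℝ≥0∞ :=
  ∑' k, costM α (T k)

/-- `S = ∑_k T_k` as currents: the partial sums converge to `S` weakly. -/
def IsSumOfCurrents {m : ℕ} (S : RectifiableCurrent m) (T : ℕ → RectifiableCurrent m) : Prop :=
  ∀ ω : OneForm m, Tendsto (fun n : ℕ => ∑ k ∈ Finset.range n, (T k).toCurrent ω) atTop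
    (𝓝 (S.toCurrent ω))

end

end CapacityTransport

/-! The inequality is pointwise. Since `θ_k ≤ ‖μ_k^-‖ ≤ c`, every path contributes to a point `x` a
ratio `t_k = θ_k(x)/c` in `[0,1]`. Adding such a `t` to the load raises the profile `⌊s⌋ + (s -
⌊s⌋)^α` by at most `t^α` (`unitProfile_add_le`): without a carry this is subadditivity of the power,
with a carry it is concavity. Induction, with a small tail treated as one last summand, bounds the
profile of `∑ t_k` by `∑ t_k^α`. The multiplicity of `T` is the norm of `∑ θ_k ξ_k`. Opposite
orientations may cancel, so it is only at most `∑ θ_k`, and monotonicity of the profile closes the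
gap.

To integrate this, the density of `T` has to be identified with `∑ θ_k ξ_k` almost everywhere. If
the cost is infinite there is nothing to prove; otherwise `θ_k ≤ c^(1-α) θ_k^α` makes the total mass
finite, the densities are absolutely summable in `L¹(ℋ¹)`, and their sum represents the weak limit.
The boundary is found by testing on `df`.

For existence, `∑ θ_k ξ_k` must be a multiple of a unit approximate tangent. Differentiation with
respect to `θ_k ℋ¹` shows that at almost every point of `M_k` the blow-ups of any integrable density
lie along `ℝ ξ_k` (`ae_tendsto_blowup_of_mem`). Applied to `‖∑ θ_k ξ_k‖`, this makes all the `ξ_k`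
at a point parallel where the sum is nonzero, and the sum spans their common line. -/

namespace CapacityTransport

/-! ### Subadditivity of the capacity profile -/

/-- The power `t ^ α` with the convention `0 ^ 0 = 0`. -/
noncomputable def powZero (α t : ℝ) : ℝ := if t = 0 then 0 else t ^ α

theorem powZero_zero (α : ℝ) : powZero α 0 = 0 := if_pos rfl

theorem powZero_of_pos (α : ℝ) {t : ℝ} (ht : 0 < t) : powZero α t = t ^ α := if_neg ht.ne'

theorem powZero_one (α : ℝ) : powZero α 1 = 1 := by simp [powZero]

theorem powZero_nonneg (α : ℝ) {t : ℝ} (ht : 0 ≤ t) : 0 ≤ powZero α t := by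
  unfold powZero; split_ifs
  · exact le_rfl
  · exact Real.rpow_nonneg ht α

theorem powZero_le_rpow (α : ℝ) {t : ℝ} (ht : 0 ≤ t) : powZero α t ≤ t ^ α := by
  unfold powZero; split_ifs
  · exact Real.rpow_nonneg ht α
  · exact le_rfl

theorem powZero_mono {α s t : ℝ} (hα : 0 ≤ α) (hs : 0 ≤ s) (hst : s ≤ t) :
    powZero α s ≤ powZero α t := by
  rcases hs.eq_or_lt with rfl | hs'
  · rw [powZero_zero]; exact powZero_nonneg α hst
  · rw [powZero_of_pos α hs', powZero_of_pos α (hs'.trans_le hst)]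
    exact Real.rpow_le_rpow hs hst hα

theorem powZero_le_one {α t : ℝ} (hα : 0 ≤ α) (ht : 0 ≤ t) (ht1 : t ≤ 1) : powZero α t ≤ 1 :=
  (powZero_mono hα ht ht1).trans_eq (powZero_one α)

/-- A slope bound for the concave function `t ^ α`. -/
theorem mul_rpow_sub_one_le_powZero {α t r : ℝ} (hα : α ≤ 1) (ht : 0 ≤ t) (htr : t ≤ r) :
    t * r ^ (α - 1) ≤ powZero α t := by
  rcases ht.eq_or_lt with rfl | ht'
  · simp [powZero_zero]
  · rw [powZero_of_pos α ht']
    calc t * r ^ (α - 1) ≤ t * t ^ (α - 1) := by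
          gcongr ?_ * ?_
          exact Real.rpow_le_rpow_of_nonpos ht' htr (by linarith)
      _ = t ^ α := by
          rw [Real.rpow_sub_one ht'.ne']; field_simp

/-- The slope bound, used for every term with `r` equal to the whole sum, adds up to the claim. -/
theorem powZero_tsum_le {α : ℝ} (hα : α ≤ 1) {t : ℕ → ℝ} (ht : ∀ k, 0 ≤ t k)
    (hs : Summable t) (hs' : Summable fun k => powZero α (t k)) :
    powZero α (∑' k, t k) ≤ ∑' k, powZero α (t k) := by
  rcases (tsum_nonneg ht).eq_or_lt with h | h
  · rw [← h, powZero_zero]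
    exact tsum_nonneg fun k => powZero_nonneg α (ht k)
  · rw [powZero_of_pos α h]
    calc (∑' k, t k) ^ α = (∑' k, t k) * (∑' k, t k) ^ (α - 1) := by
          rw [Real.rpow_sub_one h.ne', mul_div_cancel₀ _ h.ne']
      _ = ∑' k, t k * (∑' k, t k) ^ (α - 1) := by rw [tsum_mul_right]
      _ ≤ ∑' k, powZero α (t k) :=
          (hs.mul_right _).tsum_le_tsum (fun k => mul_rpow_sub_one_le_powZero hα (ht k)
            (hs.le_tsum k fun j _ => ht j)) hs'

theorem powZero_add_le {α s t : ℝ} (hα : α ≤ 1) (hs : 0 ≤ s) (ht : 0 ≤ t) :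
    powZero α (s + t) ≤ powZero α s + powZero α t := by
  rcases (add_nonneg hs ht).eq_or_lt with h | h
  · rw [← h, powZero_zero]
    exact add_nonneg (powZero_nonneg α hs) (powZero_nonneg α ht)
  · have h1 := mul_rpow_sub_one_le_powZero hα hs (by linarith : s ≤ s + t)
    have h2 := mul_rpow_sub_one_le_powZero hα ht (by linarith : t ≤ s + t)
    have h3 : (s + t) ^ α = (s + t) * (s + t) ^ (α - 1) := by
      rw [Real.rpow_sub_one h.ne']; field_simp
    rw [powZero_of_pos α h, h3, add_mul]
    exact add_le_add h1 h2

/-- Both `s` and `t` are convex combinations of `1` and `s + t - 1`, with the two weights exchanged.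
Adding the two concavity inequalities makes the weights sum to one. The cases `s = 1` and `t = 1`
are split off to keep the denominator `2 - s - t` positive. -/
theorem one_add_powZero_le {α s t : ℝ} (hα : α ∈ Icc (0 : ℝ) 1) (hs : 0 ≤ s) (hs1 : s ≤ 1)
    (ht : 0 ≤ t) (ht1 : t ≤ 1) (hst : 1 ≤ s + t) :
    1 + powZero α (s + t - 1) ≤ powZero α s + powZero α t := by
  rcases hs1.eq_or_lt with rfl | hs1'
  · simp [powZero_one]
  have ht0 : 0 < t := by linarith
  rcases ht1.eq_or_lt with rfl | ht1'
  · simp [powZero_one, add_comm]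
  have hs0 : 0 < s := by linarith
  have hd : 0 < 2 - s - t := by linarith
  have hq : s + t - 1 ∈ Ici (0 : ℝ) := by simp only [mem_Ici]; linarith
  have hc := (Real.concaveOn_rpow hα.1 hα.2).2 (mem_Ici.2 zero_le_one) hq
  have h1 := hc (div_nonneg (by linarith : 0 ≤ 1 - t) hd.le)
    (div_nonneg (by linarith : 0 ≤ 1 - s) hd.le) (by field_simp; ring)
  have h2 := hc (div_nonneg (by linarith : 0 ≤ 1 - s) hd.le)
    (div_nonneg (by linarith : 0 ≤ 1 - t) hd.le) (by field_simp; ring)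
  have e1 : ((1 - t) / (2 - s - t)) • (1 : ℝ) + ((1 - s) / (2 - s - t)) • (s + t - 1) = s := by
    simp only [smul_eq_mul]; field_simp; ring
  have e2 : ((1 - s) / (2 - s - t)) • (1 : ℝ) + ((1 - t) / (2 - s - t)) • (s + t - 1) = t := by
    simp only [smul_eq_mul]; field_simp; ring
  have e3 : (1 - t) / (2 - s - t) + (1 - s) / (2 - s - t) = 1 := by field_simp; ring
  simp only [e1, e2, Real.one_rpow] at h1 h2
  simp only [smul_eq_mul] at h1 h2
  rw [powZero_of_pos α hs0, powZero_of_pos α ht0]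
  have h4 := powZero_le_rpow α hq
  have h5 : (1 - s) / (2 - s - t) = 1 - (1 - t) / (2 - s - t) := by linarith
  rw [h5] at h1 h2
  nlinarith

/-- The unit capacity cost profile `⌊s⌋ + (s - ⌊s⌋) ^ α`. -/
noncomputable def unitProfile (α s : ℝ) : ℝ := (⌊s⌋ : ℝ) + powZero α (Int.fract s)

theorem capacityProfile_eq (α c t : ℝ) : capacityProfile α c t = unitProfile α (t / c) := rfl

theorem unitProfile_mono {α s t : ℝ} (hα : 0 ≤ α) (hst : s ≤ t) :
    unitProfile α s ≤ unitProfile α t := by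
  unfold unitProfile
  rcases (Int.floor_mono hst).eq_or_lt with h | h
  · rw [h]
    have : Int.fract s ≤ Int.fract t := by
      rw [Int.fract, Int.fract, h]; linarith
    linarith [powZero_mono hα (Int.fract_nonneg s) this]
  · have h1 : (⌊s⌋ : ℝ) + 1 ≤ ⌊t⌋ := by exact_mod_cast h
    have h2 := powZero_le_one hα (Int.fract_nonneg s) (Int.fract_lt_one s).le
    have h3 := powZero_nonneg α (Int.fract_nonneg t)
    linarith

/-- If the fractional part of `s` plus `t` stays below `1`, subadditivity of the power suffices;
otherwise one unit is carried to the floor and `one_add_powZero_le` pays for it. -/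
theorem unitProfile_add_le {α s t : ℝ} (hα : α ∈ Icc (0 : ℝ) 1) (ht : 0 ≤ t) (ht1 : t ≤ 1) :
    unitProfile α (s + t) ≤ unitProfile α s + powZero α t := by
  have hf := Int.fract_nonneg s
  have hf1 := Int.fract_lt_one s
  have hsf : (⌊s⌋ : ℝ) + Int.fract s = s := Int.floor_add_fract s
  unfold unitProfile
  rcases lt_or_ge (Int.fract s + t) 1 with h | h
  · have h1 : ⌊s + t⌋ = ⌊s⌋ := by
      rw [Int.floor_eq_iff]; constructor <;> linarith
    have h2 : Int.fract (s + t) = Int.fract s + t := by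
      rw [Int.fract, h1]; linarith
    rw [h1, h2]
    linarith [powZero_add_le hα.2 hf ht]
  · have h1 : ⌊s + t⌋ = ⌊s⌋ + 1 := by
      rw [Int.floor_eq_iff]; push_cast; constructor <;> linarith
    have h2 : Int.fract (s + t) = Int.fract s + t - 1 := by
      rw [Int.fract, h1]; push_cast; linarith
    rw [h1, h2]
    push_cast
    linarith [one_add_powZero_le hα hf hf1.le ht ht1 h]

theorem unitProfile_sum_le {α : ℝ} (hα : α ∈ Icc (0 : ℝ) 1) {t : ℕ → ℝ} (ht : ∀ k, 0 ≤ t k)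
    (ht1 : ∀ k, t k ≤ 1) (n : ℕ) :
    unitProfile α (∑ k ∈ Finset.range n, t k) ≤ ∑ k ∈ Finset.range n, powZero α (t k) := by
  induction n with
  | zero => simp [unitProfile, powZero_zero]
  | succ n ih =>
    rw [Finset.sum_range_succ, Finset.sum_range_succ]
    exact (unitProfile_add_le hα (ht n) (ht1 n)).trans (by linarith)

theorem unitProfile_tsum_le {α : ℝ} (hα : α ∈ Icc (0 : ℝ) 1) {t : ℕ → ℝ} (ht : ∀ k, 0 ≤ t k)
    (ht1 : ∀ k, t k ≤ 1) (hs : Summable t) (hs' : Summable fun k => powZero α (t k)) :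
    unitProfile α (∑' k, t k) ≤ ∑' k, powZero α (t k) := by
  -- Choose `n` so late that the tail is at most `1`: the whole tail then counts as a single
  -- admissible summand.
  obtain ⟨n, hn⟩ := ((tendsto_sum_nat_add t).eventually_le_const zero_lt_one).exists
  rw [← hs.sum_add_tsum_nat_add n, ← hs'.sum_add_tsum_nat_add n]
  have h1 := unitProfile_add_le (s := ∑ k ∈ Finset.range n, t k) hα
    (tsum_nonneg fun k => ht (k + n)) hn
  have h2 := powZero_tsum_le hα.2 (fun k => ht (k + n)) ((summable_nat_add_iff n).2 hs)
    ((summable_nat_add_iff n).2 hs')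
  linarith [unitProfile_sum_le hα ht ht1 n]

theorem rpow_mul_powZero_div {α c t : ℝ} (hc : 0 < c) (ht : 0 ≤ t) :
    c ^ α * powZero α (t / c) = powZero α t := by
  rcases ht.eq_or_lt with rfl | ht
  · simp [powZero_zero]
  · rw [powZero_of_pos α ht, powZero_of_pos α (div_pos ht hc), Real.div_rpow ht.le hc.le]
    field_simp [(Real.rpow_pos_of_pos hc α).ne']

theorem summable_of_powZero {α c : ℝ} (hα : α ≤ 1) (hc : 0 < c) {t : ℕ → ℝ}
    (ht : ∀ k, 0 ≤ t k) (htc : ∀ k, t k ≤ c) (hs : Summable fun k => powZero α (t k)) :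
    Summable t := by
  have hp : 0 < c ^ (α - 1) := Real.rpow_pos_of_pos hc _
  refine (summable_mul_right_iff hp.ne').1 ?_
  exact Summable.of_nonneg_of_le (fun k => mul_nonneg (ht k) hp.le)
    (fun k => mul_rpow_sub_one_le_powZero hα (ht k) (htc k)) hs

/-- The hypothesis on `s` is an inequality because vector densities may cancel. Comparing in `ℝ≥0∞`
covers a divergent right side. -/
theorem ofReal_capacityProfile_le {α c : ℝ} (hα : α ∈ Icc (0 : ℝ) 1) (hc : 0 < c) {t : ℕ → ℝ}
    (ht : ∀ k, 0 ≤ t k) (htc : ∀ k, t k ≤ c) {s : ℝ}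
    (hs : ENNReal.ofReal s ≤ ∑' k, ENNReal.ofReal (t k)) :
    ENNReal.ofReal (c ^ α) * ENNReal.ofReal (capacityProfile α c s) ≤
      ∑' k, ENNReal.ofReal (powZero α (t k)) := by
  by_cases htop : ∑' k, ENNReal.ofReal (powZero α (t k)) = ∞
  · rw [htop]; exact le_top
  have hsum : Summable fun k => powZero α (t k) := by
    refine (ENNReal.summable_toReal htop).congr fun k => ?_
    rw [ENNReal.toReal_ofReal (powZero_nonneg α (ht k))]
  have hsum' := summable_of_powZero hα.2 hc ht htc hsum
  rw [← ENNReal.ofReal_tsum_of_nonneg ht hsum',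
    ENNReal.ofReal_le_ofReal_iff (tsum_nonneg ht)] at hs
  rw [← ENNReal.ofReal_tsum_of_nonneg (fun k => powZero_nonneg α (ht k)) hsum,
    ← ENNReal.ofReal_mul (Real.rpow_nonneg hc.le α)]
  refine ENNReal.ofReal_le_ofReal ?_
  have hp : 0 < c ^ α := Real.rpow_pos_of_pos hc α
  have hconv : ∀ k, c ^ α * powZero α (t k / c) = powZero α (t k) :=
    fun k => rpow_mul_powZero_div hc (ht k)
  have hsumc : Summable fun k => powZero α (t k / c) := by
    refine (summable_mul_left_iff hp.ne').1 (hsum.congr fun k => (hconv k).symm)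
  calc c ^ α * capacityProfile α c s ≤ c ^ α * unitProfile α (∑' k, t k / c) := by
        rw [capacityProfile_eq, tsum_div_const]
        gcongr
        exact unitProfile_mono hα.1 (by gcongr)
    _ ≤ c ^ α * ∑' k, powZero α (t k / c) := by
        gcongr
        exact unitProfile_tsum_le hα (fun k => div_nonneg (ht k) hc.le)
          (fun k => (div_le_one hc).2 (htc k)) (hsum'.div_const c) hsumc
    _ = ∑' k, powZero α (t k) := by
        rw [← tsum_mul_left]; simp_rw [hconv]

/-! ### Differentiation of measures and blow-ups -/

open Metric in
-- This is Lebesgue differentiation of `h / g` with respect to `g μ`. That measure is finite even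
-- when `μ` is not locally finite (as for `ℋ¹`), so Besicovitch's theorem applies to it.
theorem ae_tendsto_setIntegral_abs_sub_div {m : ℕ} {μ : Measure (E m)} {g h : E m → ℝ}
    (hg : Integrable g μ) (hg0 : ∀ x, 0 ≤ g x) (hh : Integrable h μ) :
    ∀ᵐ x ∂μ, 0 < g x →
      (∀ᶠ s in 𝓝[>] (0 : ℝ), 0 < ∫ y in closedBall x s, g y ∂μ) ∧
      Tendsto (fun s : ℝ => (∫ y in closedBall x s, |h y - h x / g x * g y| ∂μ) /
        ∫ y in closedBall x s, g y ∂μ) (𝓝[>] 0) (𝓝 0) := by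
  classical
  -- The measure `g μ` does not see `h` on `{g = 0}`. That part, `k μ`, is singular to `g μ`, so its
  -- density with respect to `g μ` vanishes almost everywhere.
  set k : E m → ℝ := fun y => if g y = 0 then |h y| else 0 with hk
  have hgm : AEMeasurable (fun y => ENNReal.ofReal (g y)) μ := hg.aemeasurable.ennreal_ofReal
  have hns : NullMeasurableSet {y | g y = 0} μ :=
    hg.aemeasurable.nullMeasurableSet_preimage (measurableSet_singleton 0)
  have hki : Integrable k μ := by
    have := hh.abs.indicator₀ hns
    refine this.congr (Eventually.of_forall fun y => ?_)
    simp [hk, indicator]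
  have hk0 : ∀ y, 0 ≤ k y := fun y => by simp only [hk]; split_ifs <;> positivity
  have hkm : AEMeasurable (fun y => ENNReal.ofReal (k y)) μ := hki.aemeasurable.ennreal_ofReal
  set ρ := μ.withDensity fun y => ENNReal.ofReal (g y) with hρ
  set ν := μ.withDensity fun y => ENNReal.ofReal (k y) with hν
  have : IsFiniteMeasure ρ := isFiniteMeasure_withDensity_ofReal hg.2
  have : IsFiniteMeasure ν := isFiniteMeasure_withDensity_ofReal hki.2
  have hsing : ν ⟂ₘ ρ := by
    refine Measure.MutuallySingular.mk (s := {y | g y ≠ 0}) (t := {y | g y = 0}) ?_ ?_ ?_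
    · rw [hν, withDensity_apply_eq_zero' hkm]
      convert measure_empty (μ := μ)
      ext y; by_cases hy : g y = 0 <;> simp [hk, hy]
    · rw [hρ, withDensity_apply_eq_zero' hgm]
      convert measure_empty (μ := μ)
      ext y; by_cases hy : g y = 0 <;> simp [hy]
    · intro y _; exact (ne_or_eq (g y) 0)
  have hfi : Integrable (fun y => h y / g y) ρ := by
    rw [hρ, integrable_withDensity_iff_integrable_smul₀' hgm
      (Eventually.of_forall fun _ => ENNReal.ofReal_lt_top)]
    have := hh.indicator₀ hns.compl
    refine this.congr (Eventually.of_forall fun y => ?_)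
    by_cases hy : g y = 0
    · simp [hy]
    · simp [hy, ENNReal.toReal_ofReal (hg0 y)]; field_simp
  have hρr : ∀ B, MeasurableSet B → ρ.real B = ∫ y in B, g y ∂μ := fun B hB => by
    rw [Measure.real, hρ, withDensity_apply _ hB,
      integral_eq_lintegral_of_nonneg_ae (Eventually.of_forall hg0) hg.1.restrict]
  have hνr : ∀ B, MeasurableSet B → ν.real B = ∫ y in B, k y ∂μ := fun B hB => by
    rw [Measure.real, hν, withDensity_apply _ hB,
      integral_eq_lintegral_of_nonneg_ae (Eventually.of_forall hk0) hki.1.restrict]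
  let v := Besicovitch.vitaliFamily ρ
  have h1 := v.ae_tendsto_average_norm_sub hfi.locallyIntegrable
  have h2 := v.ae_eventually_measure_zero_of_singular hsing
  have h3 := v.ae_eventually_measure_pos
  have key : ∀ᵐ x ∂ρ, (∀ᶠ s in 𝓝[>] (0 : ℝ), 0 < ∫ y in closedBall x s, g y ∂μ) ∧
      Tendsto (fun s : ℝ => (∫ y in closedBall x s, |h y - h x / g x * g y| ∂μ) /
        ∫ y in closedBall x s, g y ∂μ) (𝓝[>] 0) (𝓝 0) := by
    filter_upwards [h1, h2, h3] with x hx1 hx2 hx3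
    have hball := Besicovitch.tendsto_filterAt ρ x
    replace hx1 := hx1.comp hball
    replace hx2 := (ENNReal.tendsto_toReal ENNReal.zero_ne_top).comp (hx2.comp hball)
    replace hx3 := hball.eventually hx3
    refine ⟨hx3.mono fun s hs => ?_, ?_⟩
    · rw [← hρr _ measurableSet_closedBall]
      exact ENNReal.toReal_pos hs.ne' (measure_ne_top _ _)
    · have := hx1.add hx2
      simp only [ENNReal.toReal_zero, add_zero] at this
      refine this.congr fun s => ?_
      have hB : MeasurableSet (closedBall x s) := measurableSet_closedBall
      simp only [Function.comp_apply, ENNReal.toReal_div]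
      change _ + ν.real _ / ρ.real _ = _
      rw [setAverage_eq, smul_eq_mul, ← hρr _ hB, inv_mul_eq_div, ← add_div, hνr _ hB]
      congr 1
      rw [hρ, setIntegral_withDensity_eq_setIntegral_toReal_smul₀ hgm.restrict
        (Eventually.of_forall fun _ => ENNReal.ofReal_lt_top) _ hB, ← integral_add]
      · refine integral_congr_ae (Eventually.of_forall fun y => ?_)
        by_cases hy : g y = 0
        · simp [hk, hy]
        · have hy' : 0 < g y := lt_of_le_of_ne (hg0 y) (Ne.symm hy)
          simp only [hk, hy, if_false, add_zero, ENNReal.toReal_ofReal (hg0 y), smul_eq_mul,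
            Real.norm_eq_abs]
          rw [← abs_of_pos hy', ← abs_mul, abs_of_pos hy']
          congr 1
          field_simp
      · have h4 := (hfi.sub (integrable_const (h x / g x))).norm
        rw [hρ, integrable_withDensity_iff_integrable_smul₀' hgm
          (Eventually.of_forall fun _ => ENNReal.ofReal_lt_top)] at h4
        exact h4.restrict
      · exact hki.restrict
  rw [hρ, ae_withDensity_iff' hgm] at key
  filter_upwards [key] with x hx hgx
  exact hx (by simpa using hgx)

/-- If the blow-ups at `x` of `g μ` converge, then so do those of `h μ`, for almost every `x` at
which `g` is positive. -/
theorem ae_tendsto_blowup {m : ℕ} {μ : Measure (E m)} {g h : E m → ℝ}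
    (hg : Integrable g μ) (hg0 : ∀ x, 0 ≤ g x) (hh : Integrable h μ) :
    ∀ᵐ x ∂μ, 0 < g x → ∀ L : (E m → ℝ) → ℝ,
      (∀ φ : E m → ℝ, Continuous φ → HasCompactSupport φ →
        Tendsto (fun r : ℝ => r⁻¹ * ∫ y, φ (r⁻¹ • (y - x)) * g y ∂μ) (𝓝[>] 0) (𝓝 (L φ))) →
      ∀ φ : E m → ℝ, Continuous φ → HasCompactSupport φ →
        Tendsto (fun r : ℝ => r⁻¹ * ∫ y, φ (r⁻¹ • (y - x)) * h y ∂μ) (𝓝[>] 0)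
          (𝓝 (h x / g x * L φ)) := by
  filter_upwards [ae_tendsto_setIntegral_abs_sub_div hg hg0 hh] with x hx hgx L hL φ hφ hφc
  obtain ⟨hpos, hlim⟩ := hx hgx
  set f := h x / g x with hf
  obtain ⟨C, hC⟩ := hφ.bounded_above_of_compact_support hφc
  obtain ⟨R, hR0, hR⟩ : ∃ R : ℝ, 0 < R ∧ ∀ z, φ z ≠ 0 → ‖z‖ ≤ R := by
    obtain ⟨R, hR0, hR⟩ := hφc.isCompact.isBounded.exists_pos_norm_le
    exact ⟨R, hR0, fun z hz => hR z (subset_tsupport _ hz)⟩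
  have hC0 : 0 ≤ C := (norm_nonneg _).trans (hC 0)
  -- The bump dominates the indicator of the ball of radius `R`, so convergence of its blow-ups
  -- bounds the `g`-mass of `closedBall x (R * r)` by a multiple of `r`.
  let ψ : ContDiffBump (0 : E m) := ⟨R, R + 1, hR0, by linarith⟩
  have hψL := hL ψ ψ.continuous ψ.hasCompactSupport
  have hint : ∀ {u : E m → ℝ} {w : E m → ℝ} (r : ℝ), Continuous w → (∃ C, ∀ z, ‖w z‖ ≤ C) →
      Integrable u μ → Integrable (fun y => w (r⁻¹ • (y - x)) * u y) μ := by
    rintro u w r hw ⟨C, hC⟩ hu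
    exact hu.bdd_mul (by fun_prop) (Eventually.of_forall fun y => hC _)
  have hscale : Tendsto (fun r : ℝ => R * r) (𝓝[>] 0) (𝓝[>] 0) := by
    refine tendsto_nhdsWithin_iff.2 ⟨?_, ?_⟩
    · have : Tendsto (fun r : ℝ => R * r) (𝓝 0) (𝓝 (R * 0)) := tendsto_id.const_mul R
      rw [mul_zero] at this
      exact this.mono_left nhdsWithin_le_nhds
    · filter_upwards [self_mem_nhdsWithin] with r hr
      exact mul_pos hR0 hr
  have hball : ∀ {r : ℝ}, 0 < r → ∀ y, y ∈ Metric.closedBall x (R * r) ↔ ‖r⁻¹ • (y - x)‖ ≤ R := by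
    intro r hr y
    rw [norm_smul, Real.norm_of_nonneg (inv_pos.2 hr).le, inv_mul_le_iff₀ hr, mem_closedBall_iff_norm,
      mul_comm]
  have herr : Tendsto (fun r : ℝ => r⁻¹ * ∫ y, φ (r⁻¹ • (y - x)) * (h y - f * g y) ∂μ) (𝓝[>] 0)
      (𝓝 0) := by
    have hb := ((hlim.comp hscale).mul hψL).const_mul C
    rw [zero_mul, mul_zero] at hb
    refine squeeze_zero_norm' ?_ hb
    filter_upwards [self_mem_nhdsWithin, hscale.eventually hpos] with r hr hpos'
    replace hr : 0 < r := hr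
    have hu : Integrable (fun y => h y - f * g y) μ := hh.sub (hg.const_mul f)
    set I := ∫ y in Metric.closedBall x (R * r), g y ∂μ with hI
    set J := ∫ y in Metric.closedBall x (R * r), |h y - f * g y| ∂μ with hJ
    have hJ0 : 0 ≤ J := integral_nonneg fun y => abs_nonneg _
    have e1 : ‖∫ y, φ (r⁻¹ • (y - x)) * (h y - f * g y) ∂μ‖ ≤ C * J := by
      refine (norm_integral_le_integral_norm _).trans ?_
      rw [hJ, ← integral_const_mul, ← integral_indicator measurableSet_closedBall]
      refine integral_mono (hint r hφ ⟨C, hC⟩ hu).norm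
        ((hu.abs.const_mul C).indicator measurableSet_closedBall) fun y => ?_
      by_cases hy : y ∈ Metric.closedBall x (R * r)
      · simp only [indicator_of_mem hy, norm_mul, Real.norm_eq_abs]
        gcongr
        exact hC _
      · have : φ (r⁻¹ • (y - x)) = 0 := by
          by_contra hne
          exact hy ((hball hr y).2 (hR _ hne))
        simp [indicator_of_notMem hy, this]
    have e2 : I ≤ ∫ y, ψ (r⁻¹ • (y - x)) * g y ∂μ := by
      rw [hI, ← integral_indicator measurableSet_closedBall]
      refine integral_mono (hg.indicator measurableSet_closedBall)
        (hint r ψ.continuous ⟨1, fun z => ?_⟩ hg) fun y => ?_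
      · rw [Real.norm_of_nonneg ψ.nonneg]; exact ψ.le_one
      by_cases hy : y ∈ Metric.closedBall x (R * r)
      · have : ψ (r⁻¹ • (y - x)) = 1 :=
          ψ.one_of_mem_closedBall (by simpa using (hball hr y).1 hy)
        simp [indicator_of_mem hy, this]
      · simp only [indicator_of_notMem hy]
        exact mul_nonneg ψ.nonneg (hg0 y)
    have e3 : J = J / I * I := by field_simp
    calc ‖r⁻¹ * ∫ y, φ (r⁻¹ • (y - x)) * (h y - f * g y) ∂μ‖
        ≤ r⁻¹ * (C * J) := by
          rw [norm_mul, Real.norm_of_nonneg (inv_pos.2 hr).le]; gcongr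
      _ = C * (J / I * (r⁻¹ * I)) := by field_simp
      _ ≤ C * (J / I * (r⁻¹ * ∫ y, ψ (r⁻¹ • (y - x)) * g y ∂μ)) := by
          have : 0 ≤ J / I := div_nonneg hJ0 hpos'.le
          gcongr
  have hfin := herr.add ((hL φ hφ hφc).const_mul f)
  rw [zero_add] at hfin
  refine hfin.congr fun r => ?_
  have e4 : ∫ y, φ (r⁻¹ • (y - x)) * h y ∂μ = ∫ y, φ (r⁻¹ • (y - x)) * (h y - f * g y) ∂μ +
      f * ∫ y, φ (r⁻¹ • (y - x)) * g y ∂μ := by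
    have hu : Integrable (fun y => h y - f * g y) μ := hh.sub (hg.const_mul f)
    rw [← integral_const_mul, ← integral_add (hint r hφ ⟨C, hC⟩ hu)
      ((hint r hφ ⟨C, hC⟩ hg).const_mul f)]
    refine integral_congr_ae (Eventually.of_forall fun y => ?_)
    ring
  rw [e4]; ring

/-- A unit vector is determined up to sign by the line it spans, seen as a measure. -/
theorem eq_or_eq_neg_of_integral_line_eq {m : ℕ} {v w : E m} (hv : ‖v‖ = 1) (hw : ‖w‖ = 1)
    (h : ∀ φ : E m → ℝ, Continuous φ → HasCompactSupport φ →
      ∫ t : ℝ, φ (t • v) = ∫ t : ℝ, φ (t • w)) : v = w ∨ v = -w := by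
  by_cases hmem : v ∈ Submodule.span ℝ {w}
  · obtain ⟨t, rfl⟩ := Submodule.mem_span_singleton.1 hmem
    rw [norm_smul, hw, mul_one, Real.norm_eq_abs] at hv
    rcases (abs_eq zero_le_one).1 hv with rfl | rfl <;> simp
  exfalso
  have hcl : IsClosed (Submodule.span ℝ {w} : Set (E m)) := Submodule.closed_of_finiteDimensional _
  obtain ⟨ε, hε, hball⟩ := Metric.isOpen_iff.1 hcl.isOpen_compl v hmem
  -- A bump around `v` that misses the line `ℝ w` has zero integral along that line and positive
  -- integral along `ℝ v`.
  let ψ : ContDiffBump v := ⟨ε / 2, ε, by linarith, by linarith⟩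
  have h0 : ∫ t : ℝ, ψ (t • w) = 0 := by
    refine integral_eq_zero_of_ae (Eventually.of_forall fun t => ?_)
    by_contra hne
    have : t • w ∈ Function.support ψ := hne
    rw [ψ.support_eq] at this
    exact hball this (Submodule.smul_mem _ t (Submodule.mem_span_singleton_self w))
  have hcont : Continuous fun t : ℝ => ψ (t • v) := ψ.continuous.comp (by fun_prop)
  have hemb : IsClosedEmbedding fun t : ℝ => t • v :=
    isClosedEmbedding_smul_left (norm_ne_zero_iff.1 (by rw [hv]; exact one_ne_zero))
  have hpos : 0 < ∫ t : ℝ, ψ (t • v) := by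
    refine hcont.integral_pos_of_hasCompactSupport_nonneg_nonzero
      (ψ.hasCompactSupport.comp_isClosedEmbedding hemb) (fun t => ψ.nonneg) (x := 1) ?_
    rw [one_smul, ψ.one_of_mem_closedBall (Metric.mem_closedBall_self ψ.rIn_pos.le)]
    exact one_ne_zero
  rw [h ψ ψ.continuous ψ.hasCompactSupport, h0] at hpos
  exact lt_irrefl _ hpos

/-! ### Vector densities of rectifiable currents -/

namespace RectifiableCurrent

variable {m : ℕ} (T : RectifiableCurrent m)

/-- The multiplicity, extended by `0` off `M`. -/
noncomputable def mult (x : E m) : ℝ := T.M.indicator T.θ x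

/-- The vector density `θ ξ` of `T` with respect to `ℋ¹`, extended by `0` off `M`. -/
noncomputable def density (x : E m) : E m := T.M.indicator (fun x => T.θ x • T.ξ x) x

theorem mult_of_mem {x : E m} (hx : x ∈ T.M) : T.mult x = T.θ x := indicator_of_mem hx _

theorem density_of_mem {x : E m} (hx : x ∈ T.M) : T.density x = T.θ x • T.ξ x :=
  indicator_of_mem hx _

theorem density_of_notMem {x : E m} (hx : x ∉ T.M) : T.density x = 0 := indicator_of_notMem hx _

theorem mult_nonneg (x : E m) : 0 ≤ T.mult x := indicator_nonneg (fun y hy => (T.θ_pos y hy).le) x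

theorem aestronglyMeasurable_mult : AEStronglyMeasurable T.mult μH[1] :=
  (aestronglyMeasurable_indicator_iff₀ T.nullMeasurableSet).2
    T.θ_locallyIntegrable.aestronglyMeasurable

theorem aestronglyMeasurable_density : AEStronglyMeasurable T.density μH[1] :=
  (aestronglyMeasurable_indicator_iff₀ T.nullMeasurableSet).2
    (T.θ_locallyIntegrable.aestronglyMeasurable.smul T.ξ_measurable)

theorem ae_norm_ξ : ∀ᵐ x ∂(μH[1] : Measure (E m)), x ∈ T.M → ‖T.ξ x‖ = 1 :=
  (ae_restrict_iff'₀ T.nullMeasurableSet).1 T.ξ_unit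

theorem ae_norm_density : ∀ᵐ x ∂(μH[1] : Measure (E m)), ‖T.density x‖ = T.mult x := by
  filter_upwards [T.ae_norm_ξ] with x hx
  by_cases hxM : x ∈ T.M
  · rw [T.density_of_mem hxM, T.mult_of_mem hxM, norm_smul, hx hxM, mul_one,
      Real.norm_of_nonneg (T.θ_pos x hxM).le]
  · rw [T.density_of_notMem hxM, mult, indicator_of_notMem hxM, norm_zero]

theorem locallyIntegrable_density : LocallyIntegrable T.density μH[1] := by
  have h : LocallyIntegrable T.mult μH[1] := by
    intro x
    obtain ⟨U, hU, hUi⟩ := T.θ_locallyIntegrable x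
    obtain ⟨V, hVU, hV, hxV⟩ := mem_nhds_iff.1 hU
    refine ⟨V, hV.mem_nhds hxV, ?_⟩
    have hi := hUi.mono_set hVU
    rw [IntegrableOn, Measure.restrict_restrict hV.measurableSet, inter_comm,
      ← Measure.restrict_restrict₀ (T.nullMeasurableSet.mono_ac
        Measure.absolutelyContinuous_restrict)] at hi
    refine ⟨T.aestronglyMeasurable_mult.restrict, ?_⟩
    have e : ∀ y, ‖T.mult y‖ₑ = T.M.indicator (fun y => ‖T.θ y‖ₑ) y := fun y => by
      rw [mult, enorm_indicator_eq_indicator_enorm]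
    simp_rw [HasFiniteIntegral, e]
    rw [lintegral_indicator₀ (T.nullMeasurableSet.mono_ac Measure.absolutelyContinuous_restrict)]
    exact hi.2
  refine h.mono T.aestronglyMeasurable_density ?_
  filter_upwards [T.ae_norm_density] with x hx
  rw [hx]; exact le_abs_self _

theorem toCurrent_eq_integral_density (ω : OneForm m) :
    T.toCurrent ω = ∫ x, ω x (T.density x) ∂μH[1] := by
  rw [T.toCurrent_apply, ← integral_indicator₀ T.nullMeasurableSet]
  congr 1; ext x
  by_cases hx : x ∈ T.M
  · simp [T.density_of_mem hx, indicator_of_mem hx]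
  · simp [T.density_of_notMem hx, indicator_of_notMem hx]

theorem setIntegral_mul_θ (φ : E m → ℝ) :
    ∫ y in T.M, φ y * T.θ y ∂μH[1] = ∫ y, φ y * T.mult y ∂μH[1] := by
  rw [← integral_indicator₀ T.nullMeasurableSet]
  congr 1; ext y
  rw [indicator_mul_right, mult]

theorem costM_eq (α : ℝ) : costM α T = ∫⁻ x, ENNReal.ofReal (powZero α (T.mult x)) ∂μH[1] := by
  rw [costM, ← lintegral_indicator₀ T.nullMeasurableSet]
  congr 1; ext x
  by_cases hx : x ∈ T.M
  · rw [indicator_of_mem hx, T.mult_of_mem hx, powZero_of_pos α (T.θ_pos x hx)]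
  · rw [indicator_of_notMem hx, mult, indicator_of_notMem hx, powZero_zero, ENNReal.ofReal_zero]

theorem costMCap_eq {α c : ℝ} :
    costMCap α c T = ENNReal.ofReal (c ^ α) *
      ∫⁻ x, ENNReal.ofReal (capacityProfile α c (T.mult x)) ∂μH[1] := by
  rw [costMCap, ← lintegral_indicator₀ T.nullMeasurableSet]
  congr 2; ext x
  by_cases hx : x ∈ T.M
  · rw [indicator_of_mem hx, T.mult_of_mem hx]
  · rw [indicator_of_notMem hx, mult, indicator_of_notMem hx]
    simp [capacityProfile]

/-- The slope bound with `r = c`: under the capacity bound, finite `α`-cost forces finite mass. -/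
theorem lintegral_mult_le {α c : ℝ} (hα : α ≤ 1) (hc : 0 < c) (hT : ∀ x ∈ T.M, T.θ x ≤ c) :
    ∫⁻ x, ENNReal.ofReal (T.mult x) ∂μH[1] ≤ ENNReal.ofReal (c ^ (1 - α)) * costM α T := by
  rw [costM_eq, ← lintegral_const_mul' _ _ ENNReal.ofReal_ne_top]
  refine lintegral_mono fun x => ?_
  rw [← ENNReal.ofReal_mul (Real.rpow_nonneg hc.le _)]
  refine ENNReal.ofReal_le_ofReal ?_
  have hxc : T.mult x ≤ c := indicator_le' (fun y hy => hT y hy) (fun _ _ => hc.le) x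
  calc T.mult x = c ^ (1 - α) * (T.mult x * c ^ (α - 1)) := by
        rw [mul_left_comm, ← Real.rpow_add hc]; simp
    _ ≤ _ := by
        gcongr
        exact mul_rpow_sub_one_le_powZero hα (T.mult_nonneg x) hxc

end RectifiableCurrent

/-! ### Weak sums of currents and their densities -/

/-- A locally integrable vector field is determined by its integrals against `1`-forms. -/
theorem ae_eq_of_integral_oneForm_eq {m : ℕ} {μ : Measure (E m)} {V W : E m → E m}
    (hV : LocallyIntegrable V μ) (hW : LocallyIntegrable W μ)
    (h : ∀ ω : OneForm m, ∫ x, ω x (V x) ∂μ = ∫ x, ω x (W x) ∂μ) : V =ᵐ[μ] W := by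
  refine ae_eq_of_integral_contDiff_smul_eq hV hW fun g hg hgc => ?_
  have hVi := hV.integrable_smul_left_of_hasCompactSupport hg.continuous hgc
  have hWi := hW.integrable_smul_left_of_hasCompactSupport hg.continuous hgc
  refine ext_inner_left ℝ fun e => ?_
  -- The form `g ⟨e, ·⟩` extracts the component of the field along `e`.
  let ω : OneForm m := ⟨fun x => g x • innerSL ℝ e, hg.smul contDiff_const, hgc.smul_right,
    fun _ _ => trivial⟩
  rw [← integral_inner hVi, ← integral_inner hWi]
  have hω : ∀ x v, ω x v = inner ℝ e (g x • v) := fun x v => by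
    change (g x • innerSL ℝ e) v = _
    simp [inner_smul_right]
  simpa only [hω] using h ω

/-- Testing the weak convergence on `df` suffices, so no bound on the cost enters. -/
theorem isTransportPath_of_isSum {m : ℕ} {c : ℝ} {μm μp : Measure (E m)} [IsFiniteMeasure μm]
    [IsFiniteMeasure μp] {νm νp : ℕ → Measure (E m)} {T : ℕ → RectifiableCurrent m}
    (hT : IsTransportMultiPath c μm μp νm νp T) {S : RectifiableCurrent m}
    (hS : IsSumOfCurrents S T) : IsTransportPath μm μp S := by
  have hm : ∀ k, IsFiniteMeasure (νm k) := fun k =>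
    ⟨(hT.mass_le k).trans_lt ENNReal.ofReal_lt_top⟩
  have hp : ∀ k, IsFiniteMeasure (νp k) := fun k =>
    ⟨((hT.mass_eq k).symm.trans_le (hT.mass_le k)).trans_lt ENNReal.ofReal_lt_top⟩
  refine ContinuousLinearMap.ext fun f => ?_
  have hfi : ∀ (μ : Measure (E m)) [IsFiniteMeasure μ], Integrable f μ := fun μ _ =>
    f.continuous.integrable_of_hasCompactSupport f.hasCompactSupport
  have h1 : HasSum (fun k => ∫ x, f x ∂νm k) (∫ x, f x ∂μm) := by
    have := hfi μm
    rw [← hT.sum_source] at this ⊢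
    exact hasSum_integral_measure this
  have h2 : HasSum (fun k => ∫ x, f x ∂νp k) (∫ x, f x ∂μp) := by
    have := hfi μp
    rw [← hT.sum_target] at this ⊢
    exact hasSum_integral_measure this
  have h3 := (h2.sub h1).tendsto_sum_nat
  have h4 := hS (extD m f)
  refine tendsto_nhds_unique h4 ?_
  rw [sub_apply, measureCurrent_apply, measureCurrent_apply]
  refine h3.congr fun n => Finset.sum_congr rfl fun k _ => ?_
  have := DFunLike.congr_fun (hT.path k) f
  rw [sub_apply, measureCurrent_apply, measureCurrent_apply] at this
  exact this.symm

section Sum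

variable {m : ℕ} {T : ℕ → RectifiableCurrent m}

/-- The sum of the vector densities of countably many rectifiable currents. -/
noncomputable def sumDensity (T : ℕ → RectifiableCurrent m) (x : E m) : E m :=
  ∑' k, (T k).density x

theorem lintegral_enorm_density (S : RectifiableCurrent m) :
    ∫⁻ x, ‖S.density x‖ₑ ∂μH[1] = ∫⁻ x, ENNReal.ofReal (S.mult x) ∂μH[1] := by
  refine lintegral_congr_ae ?_
  filter_upwards [S.ae_norm_density] with x hx
  rw [← ofReal_norm, hx]

theorem tsum_lintegral_mult_ne_top {α c : ℝ} (hα : α ≤ 1) (hc : 0 < c)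
    (hθ : ∀ k, ∀ x ∈ (T k).M, (T k).θ x ≤ c) (hcost : costMulti α T < ∞) :
    ∑' k, ∫⁻ x, ENNReal.ofReal ((T k).mult x) ∂μH[1] ≠ ∞ := by
  refine ((ENNReal.tsum_le_tsum fun k => (T k).lintegral_mult_le hα hc (hθ k)).trans_lt ?_).ne
  rw [ENNReal.tsum_mul_left]
  exact ENNReal.mul_lt_top ENNReal.ofReal_lt_top hcost


theorem integrable_density
    (hfin : ∑' k, ∫⁻ x, ENNReal.ofReal ((T k).mult x) ∂μH[1] ≠ ∞)
    (k : ℕ) : Integrable (T k).density μH[1] := by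
  refine ⟨(T k).aestronglyMeasurable_density, ?_⟩
  rw [HasFiniteIntegral, lintegral_enorm_density]
  exact (ENNReal.ne_top_of_tsum_ne_top hfin k).lt_top

theorem integrable_mult
    (hfin : ∑' k, ∫⁻ x, ENNReal.ofReal ((T k).mult x) ∂μH[1] ≠ ∞)
    (k : ℕ) : Integrable (T k).mult μH[1] :=
  (integrable_density hfin k).norm.congr (T k).ae_norm_density

theorem ae_summable_density
    (hfin : ∑' k, ∫⁻ x, ENNReal.ofReal ((T k).mult x) ∂μH[1] ≠ ∞) :
    ∀ᵐ x ∂(μH[1] : Measure (E m)), Summable fun k => (T k).density x := by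
  have h : ∫⁻ x, ∑' k, ‖(T k).density x‖ₑ ∂μH[1] ≠ ∞ := by
    rw [lintegral_tsum fun k => (T k).aestronglyMeasurable_density.enorm]
    simpa only [lintegral_enorm_density] using hfin
  filter_upwards [ae_lt_top' (AEMeasurable.tsum
    fun k => (T k).aestronglyMeasurable_density.enorm) h] with x hx
  refine Summable.of_norm ((ENNReal.summable_toReal hx.ne).congr fun k => ?_)
  rw [toReal_enorm]

theorem integrable_sumDensity
    (hfin : ∑' k, ∫⁻ x, ENNReal.ofReal ((T k).mult x) ∂μH[1] ≠ ∞) : Integrable (sumDensity T) μH[1] := by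
  constructor
  · refine aestronglyMeasurable_of_tendsto_ae atTop
      (f := fun n x => ∑ k ∈ Finset.range n, (T k).density x) (fun n => ?_) ?_
    · exact Finset.aestronglyMeasurable_fun_sum _ fun k _ => (T k).aestronglyMeasurable_density
    · filter_upwards [ae_summable_density hfin] with x hx
      exact hx.hasSum.tendsto_sum_nat
  · refine lt_of_le_of_lt (lintegral_mono fun x => enorm_tsum_le_tsum_enorm) ?_
    rw [lintegral_tsum fun k => (T k).aestronglyMeasurable_density.enorm]
    simpa only [lintegral_enorm_density] using hfin.lt_top

/-- Sum and integral may be exchanged: a test form is bounded and the masses are summable. -/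
theorem tendsto_sum_toCurrent
    (hfin : ∑' k, ∫⁻ x, ENNReal.ofReal ((T k).mult x) ∂μH[1] ≠ ∞)
    (ω : OneForm m) :
    Tendsto (fun n : ℕ => ∑ k ∈ Finset.range n, (T k).toCurrent ω) atTop
      (𝓝 (∫ x, ω x (sumDensity T x) ∂μH[1])) := by
  obtain ⟨C, hC⟩ := ω.continuous.bounded_above_of_compact_support ω.hasCompactSupport
  have hm : ∀ k, AEStronglyMeasurable (fun x => ω x ((T k).density x)) μH[1] := fun k =>
    (ContinuousLinearMap.id ℝ (E m →L[ℝ] ℝ)).aestronglyMeasurable_comp₂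
      ω.continuous.aestronglyMeasurable (T k).aestronglyMeasurable_density
  have hle : ∀ k x, ‖ω x ((T k).density x)‖ ≤ C * ‖(T k).density x‖ := fun k x =>
    ((ω x).le_opNorm _).trans (by gcongr; exact hC x)
  have hi : ∀ k, Integrable (fun x => ω x ((T k).density x)) μH[1] := fun k =>
    ((integrable_density hfin k).norm.const_mul C).mono' (hm k) (Eventually.of_forall (hle k))
  have hs : Summable fun k => ∫ x, ‖ω x ((T k).density x)‖ ∂μH[1] := by
    refine Summable.of_nonneg_of_le (fun k => integral_nonneg fun x => norm_nonneg _)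
      (fun k => integral_mono (hi k).norm ((integrable_density hfin k).norm.const_mul C) (hle k)) ?_
    simp_rw [integral_const_mul]
    refine Summable.mul_left C ((ENNReal.summable_toReal hfin).congr fun k => ?_)
    rw [← lintegral_enorm_density, integral_norm_eq_lintegral_enorm
      (T k).aestronglyMeasurable_density]
  have h := (hasSum_integral_of_summable_integral_norm hi hs).tendsto_sum_nat
  have e : ∫ x, ∑' k, ω x ((T k).density x) ∂μH[1] = ∫ x, ω x (sumDensity T x) ∂μH[1] := by
    refine integral_congr_ae ?_
    filter_upwards [ae_summable_density hfin] with x hx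
    exact ((ω x).map_tsum hx).symm
  rw [e] at h
  exact h.congr fun n => Finset.sum_congr rfl fun k _ =>
    ((T k).toCurrent_eq_integral_density ω).symm

theorem density_ae_eq_sumDensity
    (hfin : ∑' k, ∫⁻ x, ENNReal.ofReal ((T k).mult x) ∂μH[1] ≠ ∞)
    {S : RectifiableCurrent m} (hS : IsSumOfCurrents S T) :
    S.density =ᵐ[μH[1]] sumDensity T := by
  refine ae_eq_of_integral_oneForm_eq S.locallyIntegrable_density
    (integrable_sumDensity hfin).locallyIntegrable fun ω => ?_
  rw [← S.toCurrent_eq_integral_density]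
  exact tendsto_nhds_unique (hS ω) (tendsto_sum_toCurrent hfin ω)

end Sum

/-! ### Rectifiability and tangent lines of the sum -/

theorem CountablyRectifiable.iUnion {m : ℕ} {M : ℕ → Set (E m)}
    (h : ∀ k, CountablyRectifiable (M k)) : CountablyRectifiable (⋃ k, M k) := by
  choose f hf hM using h
  refine ⟨fun n => f n.unpair.1 n.unpair.2, fun n => hf _ _, ?_⟩
  refine measure_mono_null ?_ (measure_iUnion_null hM)
  rintro x ⟨hx, hx'⟩
  obtain ⟨k, hk⟩ := mem_iUnion.1 hx
  refine mem_iUnion.2 ⟨k, hk, fun hxf => hx' ?_⟩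
  obtain ⟨j, hj⟩ := mem_iUnion.1 hxf
  exact mem_iUnion.2 ⟨Nat.pair k j, by simpa using hj⟩

theorem CountablyRectifiable.mono {m : ℕ} {M N : Set (E m)} (h : CountablyRectifiable N)
    (hMN : M ⊆ N) : CountablyRectifiable M := by
  obtain ⟨f, hf, hN⟩ := h
  exact ⟨f, hf, measure_mono_null (sdiff_subset_sdiff_left hMN) hN⟩

theorem exists_mem_of_sumDensity_ne_zero {m : ℕ} {T : ℕ → RectifiableCurrent m} {x : E m}
    (hx : sumDensity T x ≠ 0) : ∃ k, x ∈ (T k).M := by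
  by_contra! h
  refine hx ?_
  rw [sumDensity]
  simp [fun k => (T k).density_of_notMem (h k)]

theorem integral_neg_line {m : ℕ} (φ : E m → ℝ) (v : E m) :
    ∫ t : ℝ, φ (t • -v) = ∫ t : ℝ, φ (t • v) := by
  rw [← integral_neg_eq_self]
  simp

/-- The blow-ups at almost every point of a component are governed by its tangent line. -/
theorem ae_tendsto_blowup_of_mem {m : ℕ} {T : RectifiableCurrent m}
    (hT : Integrable T.mult μH[1]) {h : E m → ℝ} (hh : Integrable h μH[1]) :
    ∀ᵐ x ∂(μH[1] : Measure (E m)), x ∈ T.M →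
      ∀ φ : E m → ℝ, Continuous φ → HasCompactSupport φ →
        Tendsto (fun r : ℝ => r⁻¹ * ∫ y, φ (r⁻¹ • (y - x)) * h y ∂μH[1]) (𝓝[>] 0)
          (𝓝 (h x * ∫ t : ℝ, φ (t • T.ξ x))) := by
  filter_upwards [ae_tendsto_blowup hT T.mult_nonneg hh,
    (ae_restrict_iff'₀ T.nullMeasurableSet).1 T.ξ_tangent] with x hx htan hxM φ hφ hφc
  have hpos : 0 < T.mult x := by rw [T.mult_of_mem hxM]; exact T.θ_pos x hxM
  have := hx hpos (fun φ => T.mult x * ∫ t : ℝ, φ (t • T.ξ x)) (fun ψ hψ hψc => ?_) φ hφ hφc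
  · rwa [← mul_assoc, div_mul_cancel₀ _ hpos.ne'] at this
  · rw [T.mult_of_mem hxM]
    refine (htan hxM ψ hψ hψc).congr fun r => ?_
    rw [T.setIntegral_mul_θ fun y => ψ (r⁻¹ • (y - x))]

/-- On `M_j` the blow-ups of `‖sumDensity T‖ ℋ¹` already converge to a multiple of the line `ℝ ξ_j`;
what remains is that the sum points along that line. -/
theorem ae_isApproxTangent_sumDensity {m : ℕ} {T : ℕ → RectifiableCurrent m}
    (hfin : ∑' k, ∫⁻ x, ENNReal.ofReal ((T k).mult x) ∂μH[1] ≠ ∞) :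
    ∀ᵐ x ∂(μH[1] : Measure (E m)), sumDensity T x ≠ 0 →
      IsApproxTangent {y | sumDensity T y ≠ 0} (fun y => ‖sumDensity T y‖) x
        (‖sumDensity T x‖⁻¹ • sumDensity T x) := by
  have hD := (integrable_sumDensity hfin).norm
  have h1 := ae_all_iff.2 fun k => ae_tendsto_blowup_of_mem (integrable_mult hfin k) hD
  have h2 := ae_all_iff.2 fun k => (T k).ae_norm_ξ
  filter_upwards [h1, h2, ae_summable_density hfin] with x hlim hunit hsum hx
  obtain ⟨j, hj⟩ := exists_mem_of_sumDensity_ne_zero hx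
  have hn : 0 < ‖sumDensity T x‖ := norm_pos_iff.2 hx
  have hspan : sumDensity T x ∈ Submodule.span ℝ {(T j).ξ x} := by
    have hcl : IsClosed (Submodule.span ℝ {(T j).ξ x} : Set (E m)) :=
      Submodule.closed_of_finiteDimensional _
    refine hcl.mem_of_tendsto hsum.hasSum.tendsto_sum_nat
      (Eventually.of_forall fun n => Submodule.sum_mem _ fun k _ => ?_)
    by_cases hk : x ∈ (T k).M
    · rw [(T k).density_of_mem hk]
      refine Submodule.smul_mem _ _ ?_
      -- The blow-ups of one function, `‖sumDensity T‖`, have a single limit, computed here along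
      -- both lines; its positive value at `x` cancels.
      have hline : (T k).ξ x = (T j).ξ x ∨ (T k).ξ x = -(T j).ξ x := by
        refine eq_or_eq_neg_of_integral_line_eq (hunit k hk) (hunit j hj) fun φ hφ hφc => ?_
        exact mul_left_cancel₀ hn.ne'
          (tendsto_nhds_unique (hlim k hk φ hφ hφc) (hlim j hj φ hφ hφc))
      rcases hline with e | e <;> rw [e]
      · exact Submodule.mem_span_singleton_self _
      · exact Submodule.neg_mem _ (Submodule.mem_span_singleton_self _)
    · rw [(T k).density_of_notMem hk]
      exact Submodule.zero_mem _
  obtain ⟨t, ht⟩ := Submodule.mem_span_singleton.1 hspan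
  have hnt : ‖sumDensity T x‖ = |t| := by
    rw [← ht, norm_smul, hunit j hj, mul_one, Real.norm_eq_abs]
  have hline : ∀ φ : E m → ℝ, ∫ s : ℝ, φ (s • (‖sumDensity T x‖⁻¹ • sumDensity T x)) =
      ∫ s : ℝ, φ (s • (T j).ξ x) := by
    intro φ
    have ht0 : t ≠ 0 := abs_pos.1 (hnt ▸ hn)
    rw [hnt, ← ht, smul_smul]
    rcases lt_or_gt_of_ne ht0 with h | h
    · rw [abs_of_neg h, inv_neg, neg_mul, inv_mul_cancel₀ ht0, neg_one_smul]
      exact integral_neg_line φ _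
    · rw [abs_of_pos h, inv_mul_cancel₀ ht0, one_smul]
  intro φ hφ hφc
  rw [hline φ]
  refine (hlim j hj φ hφ hφc).congr fun r => ?_
  rw [setIntegral_eq_integral_of_forall_compl_eq_zero]
  intro y hy
  have : sumDensity T y = 0 := by simpa using hy
  simp [this]

/-- The rectifiable current with vector density the sum of the densities of the `T k`. -/
noncomputable def sumCurrent {m : ℕ} (T : ℕ → RectifiableCurrent m)
    (hfin : ∑' k, ∫⁻ x, ENNReal.ofReal ((T k).mult x) ∂μH[1] ≠ ∞) : RectifiableCurrent m :=
  have hM : NullMeasurableSet {x | sumDensity T x ≠ 0} μH[1] :=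
    ((integrable_sumDensity hfin).1.aemeasurable.nullMeasurableSet_preimage
      (measurableSet_singleton 0)).compl
  { M := {x | sumDensity T x ≠ 0}
    θ := fun x => ‖sumDensity T x‖
    ξ := fun x => ‖sumDensity T x‖⁻¹ • sumDensity T x
    nullMeasurableSet := hM
    rectifiable := (CountablyRectifiable.iUnion fun k => (T k).rectifiable).mono fun _ hx =>
      mem_iUnion.2 (exists_mem_of_sumDensity_ne_zero hx)
    θ_pos := fun _ hx => norm_pos_iff.2 hx
    θ_locallyIntegrable := (integrable_sumDensity hfin).norm.restrict.locallyIntegrable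
    ξ_measurable :=
      ((integrable_sumDensity hfin).1.norm.aemeasurable.inv.aestronglyMeasurable.smul
        (integrable_sumDensity hfin).1).restrict
    ξ_unit := (ae_restrict_iff'₀ hM).2 (Eventually.of_forall fun _ hx => norm_smul_inv_norm hx)
    ξ_tangent := (ae_restrict_iff'₀ hM).2 (ae_isApproxTangent_sumDensity hfin) }

theorem sumCurrent_density {m : ℕ} {T : ℕ → RectifiableCurrent m}
    (hfin : ∑' k, ∫⁻ x, ENNReal.ofReal ((T k).mult x) ∂μH[1] ≠ ∞) (x : E m) :
    (sumCurrent T hfin).density x = sumDensity T x := by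
  by_cases hx : sumDensity T x = 0
  · rw [(sumCurrent T hfin).density_of_notMem (not_not.2 hx), hx]
  · rw [RectifiableCurrent.density_of_mem _ hx]
    exact smul_inv_smul₀ (norm_ne_zero_iff.2 hx) _

theorem isSumOfCurrents_sumCurrent {m : ℕ} {T : ℕ → RectifiableCurrent m}
    (hfin : ∑' k, ∫⁻ x, ENNReal.ofReal ((T k).mult x) ∂μH[1] ≠ ∞) :
    IsSumOfCurrents (sumCurrent T hfin) T := fun ω => by
  rw [RectifiableCurrent.toCurrent_eq_integral_density]
  simp_rw [sumCurrent_density]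
  exact tendsto_sum_toCurrent hfin ω

/-! ### The cost inequality and the conclusion -/

theorem costMCap_le_costMulti {m : ℕ} {α c : ℝ} (hα : α ∈ Icc (0 : ℝ) 1) (hc : 0 < c)
    {T : ℕ → RectifiableCurrent m} (hθ : ∀ k, ∀ x ∈ (T k).M, (T k).θ x ≤ c)
    {S : RectifiableCurrent m} (hS : IsSumOfCurrents S T) :
    costMCap α c S ≤ costMulti α T := by
  by_cases hcost : costMulti α T < ∞
  swap
  · exact le_top.trans (not_lt.1 hcost)
  have hfin := tsum_lintegral_mult_ne_top hα.2 hc hθ hcost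
  have hmeas : ∀ k, AEMeasurable (fun x => ENNReal.ofReal (powZero α ((T k).mult x)))
      (μH[1] : Measure (E m)) := fun k => by
    have hp : Measurable (powZero α) :=
      Measurable.ite (measurableSet_singleton 0) measurable_const
        (measurable_id.pow_const α)
    exact (hp.comp_aemeasurable (T k).aestronglyMeasurable_mult.aemeasurable).ennreal_ofReal
  rw [S.costMCap_eq, ← lintegral_const_mul' _ _ ENNReal.ofReal_ne_top, costMulti]
  simp_rw [RectifiableCurrent.costM_eq]
  rw [← lintegral_tsum hmeas]
  refine lintegral_mono_ae ?_
  filter_upwards [density_ae_eq_sumDensity hfin hS, S.ae_norm_density,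
    ae_all_iff.2 fun k => (T k).ae_norm_density] with x hx hxS hxT
  refine ofReal_capacityProfile_le hα hc (fun k => (T k).mult_nonneg x)
    (fun k => indicator_le' (fun y hy => hθ k y hy) (fun _ _ => hc.le) x) ?_
  rw [← hxS, hx, ofReal_norm, sumDensity]
  refine enorm_tsum_le_tsum_enorm.trans_eq (tsum_congr fun k => ?_)
  rw [← hxT k, ofReal_norm]

end CapacityTransport

theorem mainTheorem10 {m : ℕ} (α c : ℝ) (hα : α ∈ Icc (0 : ℝ) 1) (hc : 0 < c)
    (μm μp : Measure (CapacityTransport.E m)) [IsFiniteMeasure μm] [IsFiniteMeasure μp]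
    (hμm : ∃ K, IsCompact K ∧ μm Kᶜ = 0) (hμp : ∃ K, IsCompact K ∧ μp Kᶜ = 0)
    (hμ : μm univ = μp univ)
    (νm νp : ℕ → Measure (CapacityTransport.E m))
    (T : ℕ → CapacityTransport.RectifiableCurrent m)
    (hT : CapacityTransport.IsTransportMultiPath c μm μp νm νp T)
    (hθ : ∀ k, ∀ x ∈ (T k).M, ENNReal.ofReal ((T k).θ x) ≤ νm k univ) :
    (∀ S : CapacityTransport.RectifiableCurrent m, CapacityTransport.IsSumOfCurrents S T →
      CapacityTransport.IsTransportPath μm μp S ∧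
        CapacityTransport.costMCap α c S ≤ CapacityTransport.costMulti α T) ∧
    (CapacityTransport.costMulti α T < ∞ →
      ∃ S : CapacityTransport.RectifiableCurrent m, CapacityTransport.IsSumOfCurrents S T) := by
  have hθc : ∀ k, ∀ x ∈ (T k).M, (T k).θ x ≤ c := fun k x hx =>
    (ENNReal.ofReal_le_ofReal_iff hc.le).1 ((hθ k x hx).trans (hT.mass_le k))
  exact ⟨fun S hS => ⟨CapacityTransport.isTransportPath_of_isSum hT hS,
      CapacityTransport.costMCap_le_costMulti hα hc hθc hS⟩,
    fun hcost => ⟨_, CapacityTransport.isSumOfCurrents_sumCurrent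
      (CapacityTransport.tsum_lintegral_mult_ne_top hα.2 hc hθc hcost)⟩⟩
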